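/- Let $\mathcal K$ be a braided star-autonomous category: a (planar, not necessarily symmetric) linearly distributive category $(\mathcal K,\otimes,e,\oplus,d)$ (tensor $\otimes$ with unit $e$, par $\oplus$ with unit $d$) with, for every object $p$, a chosen right dual $p^*$ (with $\gamma_p\colon p\otimes p^*\to d$ and $\tau_p\colon e\to p^*\oplus p$) and a chosen left dual ${}^*p$ (with $\gamma'_p\colon {}^*p\otimes p\to d$ and $\tau'_p\colon e\to p\oplus {}^*p$), each satisfying the linear triangle identities, together with a braiding $\beta_{p,q}\colon p\otimes q\to q\otimes p$ of $\otimes$. By duality $\beta$ induces a braiding $\check\beta_{p,q}\colon p\oplus q\to q\oplus p$ of $\oplus $: it is the mate of $\beta_{p^*,q^*}\colon p^*\otimes q^*\to q^*\otimes p^*$, under the canonical identifications of $q^*\otimes p^*$ with $(p\oplus q)^*$ and of $p^*\otimes q^*$ with $(q\oplus p)^*$. A natural isomorphism $c_p\colon p^*\to{}^*p$ is called a *cycle* if, for all $p,q$, both squares $$c_{p\otimes q}\,;\,\mathsf{dm}=\mathsf{dm}\,;\,(c_q\oplus c_p)\colon (p\otimes q)^*\to{}^*q\oplus {}^*p,\qquad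 c_{p\oplus q}\,;\,\mathsf{dm}=\mathsf{dm}\,;\,(c_q\otimes c_p)\colon (p\oplus q)^*\to{}^*q\otimes{}^*p$$ commute (composition in diagrammatic order), where $\mathsf{dm}$ denotes the canonical de Morgan isomorphisms $(p\otimes q)^*\to q^*\oplus p^*$, ${}^*(p\otimes q)\to{}^*q\oplus {}^*p$, $(p\oplus q)^*\to q^*\otimes p^*$ and ${}^*(p\oplus q)\to{}^*q\otimes{}^*p$. The identity of the identity functor of $\mathcal K$ induces the operation $\mathcal K(p\otimes t,d)\to\mathcal K(t\otimes p,d)$, $\omega\mapsto\beta_{t,p}\,;\,\omega$. Let $c^{\mathrm{id}}_p\colon p^*\to{}^*p$ be the corresponding family of arrows, i.e. $c^{\mathrm{id}}_p$ is the transpose of $\beta_{p^*,p}\,;\,\gamma_p\colon p^*\otimes p\to d$. Then $c^{\mathrm{id}}$ is a cycle if and only if $\beta$ is a symmetry, that is, $\beta_{p,q}\,;\,\beta_{q,p}=\mathrm{id}_{p\otimes q}$ for all $p,q$. Moreover, if $\beta$ is a symmetry then so is the induced braiding of $\oplus $, that is, $\check\beta_{p,q}\,;\,\check\beta_{q,p}=\mathrm{id}_{p\oplus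 q}$ for all $p,q$. -/

import Mathlib

open CategoryTheory MonoidalCategory

universe v u

namespace StarAut

/-! ## Linearly distributive categories

The tensor `⊗` (unit `𝟙_ C`) is Mathlib's monoidal structure on `C`.  The par `⅋` (unit `bot C`) is
a second monoidal structure on the same category.  To keep it apart from the first one it is not an
instance, and its operations get names of their own. -/

/-- A second monoidal structure, `par`, on the category `C`. -/
class ParCategory (C : Type u) [Category.{v} C] where
  /-- The monoidal structure whose product is par. -/
  par : MonoidalCategory.{v} C

section Par

variable {C : Type u} [Category.{v} C] [ParCategory.{v} C]

/-- The par of two objects, written `X ⅋ Y`. -/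
def parObj (X Y : C) : C := @tensorObj C _ ParCategory.par.toMonoidalCategoryStruct X Y

infixr:70 " ⅋ " => StarAut.parObj

variable (C) in
/-- The unit of par. -/
def bot : C := @tensorUnit C _ ParCategory.par.toMonoidalCategoryStruct

/-- `X ⅋ f`. -/
def parL (X : C) {Y Z : C} (f : Y ⟶ Z) : X ⅋ Y ⟶ X ⅋ Z :=
  @whiskerLeft C _ ParCategory.par.toMonoidalCategoryStruct X Y Z f

/-- `f ⅋ Z`. -/
def parR {X Y : C} (f : X ⟶ Y) (Z : C) : X ⅋ Z ⟶ Y ⅋ Z :=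
  @whiskerRight C _ ParCategory.par.toMonoidalCategoryStruct X Y f Z

/-- `f ⅋ g`. -/
def parHom {X Y X' Y' : C} (f : X ⟶ Y) (g : X' ⟶ Y') : X ⅋ X' ⟶ Y ⅋ Y' :=
  @tensorHom C _ ParCategory.par.toMonoidalCategoryStruct X Y X' Y' f g

/-- The associator of par. -/
def parAssoc (X Y Z : C) : (X ⅋ Y) ⅋ Z ≅ X ⅋ (Y ⅋ Z) :=
  @associator C _ ParCategory.par.toMonoidalCategoryStruct X Y Z

/-- The left unitor of par. -/
def parLeftUnitor (X : C) : bot C ⅋ X ≅ X :=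
  @leftUnitor C _ ParCategory.par.toMonoidalCategoryStruct X

/-- The right unitor of par. -/
def parRightUnitor (X : C) : X ⅋ bot C ≅ X :=
  @rightUnitor C _ ParCategory.par.toMonoidalCategoryStruct X

end Par

/-- A (planar) linearly distributive category: two monoidal structures on one category, connected by
natural linear distributions `distL` and `distR`, subject to the usual ten coherence conditions. -/
class LinearlyDistributiveCategory (C : Type u) [Category.{v} C] [MonoidalCategory.{v} C]
    [ParCategory.{v} C] where
  /-- The left linear distribution. -/
  distL : ∀ X Y Z : C, X ⊗ (Y ⅋ Z) ⟶ (X ⊗ Y) ⅋ Z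
  /-- The right linear distribution. -/
  distR : ∀ X Y Z : C, (X ⅋ Y) ⊗ Z ⟶ X ⅋ (Y ⊗ Z)
  distL_natural₁ : ∀ {X X' : C} (f : X ⟶ X') (Y Z : C),
    f ▷ (Y ⅋ Z) ≫ distL X' Y Z = distL X Y Z ≫ parR (f ▷ Y) Z
  distL_natural₂ : ∀ (X : C) {Y Y' : C} (f : Y ⟶ Y') (Z : C),
    X ◁ parR f Z ≫ distL X Y' Z = distL X Y Z ≫ parR (X ◁ f) Z
  distL_natural₃ : ∀ (X Y : C) {Z Z' : C} (f : Z ⟶ Z'),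
    X ◁ parL Y f ≫ distL X Y Z' = distL X Y Z ≫ parL (X ⊗ Y) f
  distR_natural₁ : ∀ {X X' : C} (f : X ⟶ X') (Y Z : C),
    parR f Y ▷ Z ≫ distR X' Y Z = distR X Y Z ≫ parR f (Y ⊗ Z)
  distR_natural₂ : ∀ (X : C) {Y Y' : C} (f : Y ⟶ Y') (Z : C),
    parL X f ▷ Z ≫ distR X Y' Z = distR X Y Z ≫ parL X (f ▷ Z)
  distR_natural₃ : ∀ (X Y : C) {Z Z' : C} (f : Z ⟶ Z'),
    (X ⅋ Y) ◁ f ≫ distR X Y Z' = distR X Y Z ≫ parL X (Y ◁ f)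
  -- the four unit conditions
  distL_leftUnitor : ∀ X Y : C,
    distL (𝟙_ C) X Y ≫ parR (λ_ X).hom Y = (λ_ (X ⅋ Y)).hom
  distR_rightUnitor : ∀ X Y : C,
    distR X Y (𝟙_ C) ≫ parL X (ρ_ Y).hom = (ρ_ (X ⅋ Y)).hom
  distL_parRightUnitor : ∀ X Y : C,
    distL X Y (bot C) ≫ (parRightUnitor (X ⊗ Y)).hom = X ◁ (parRightUnitor Y).hom
  distR_parLeftUnitor : ∀ X Y : C,
    distR (bot C) X Y ≫ (parLeftUnitor (X ⊗ Y)).hom = (parLeftUnitor X).hom ▷ Y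
  -- the four associativity conditions
  distL_associator : ∀ X Y Z W : C,
    distL (X ⊗ Y) Z W ≫ parR (α_ X Y Z).hom W =
      (α_ X Y (Z ⅋ W)).hom ≫ X ◁ distL Y Z W ≫ distL X (Y ⊗ Z) W
  distR_associator : ∀ X Y Z W : C,
    distR X Y Z ▷ W ≫ distR X (Y ⊗ Z) W ≫ parL X (α_ Y Z W).hom =
      (α_ (X ⅋ Y) Z W).hom ≫ distR X Y (Z ⊗ W)
  distL_parAssoc : ∀ X Y Z W : C,
    distL X (Y ⅋ Z) W ≫ parR (distL X Y Z) W ≫ (parAssoc (X ⊗ Y) Z W).hom =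
      X ◁ (parAssoc Y Z W).hom ≫ distL X Y (Z ⅋ W)
  distR_parAssoc : ∀ X Y Z W : C,
    distR (X ⅋ Y) Z W ≫ (parAssoc X Y (Z ⊗ W)).hom =
      (parAssoc X Y Z).hom ▷ W ≫ distR X (Y ⅋ Z) W ≫ parL X (distR Y Z W)
  -- the two conditions that mix the distributions
  distL_distR : ∀ X Y Z W : C,
    distL X Y Z ▷ W ≫ distR (X ⊗ Y) Z W =
      (α_ X (Y ⅋ Z) W).hom ≫ X ◁ distR Y Z W ≫ distL X Y (Z ⊗ W)
  distR_distL : ∀ X Y Z W : C,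
    distR X Y (Z ⅋ W) ≫ parL X (distL Y Z W) =
      distL (X ⅋ Y) Z W ≫ parR (distR X Y Z) W ≫ (parAssoc X (Y ⊗ Z) W).hom

open LinearlyDistributiveCategory

section Duals

variable {C : Type u} [Category.{v} C] [MonoidalCategory.{v} C] [ParCategory.{v} C]
  [LinearlyDistributiveCategory.{v} C]

/-! ## Linear duals -/

/-- The data of a linear dual pair, `x` being the left dual of `y` and `y` the right dual of `x`. -/
structure Pairing (x y : C) where
  /-- The counit `γ`. -/
  counit : x ⊗ y ⟶ bot C
  /-- The unit `τ`. -/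
  unit : 𝟙_ C ⟶ y ⅋ x

namespace Pairing

/-- Transposition `(x ⊗ t ⟶ ⊥) → (t ⟶ y)` along a pairing of `x` and `y`. -/
def lCurry {x y : C} (D : Pairing x y) {t : C} (ω : x ⊗ t ⟶ bot C) : t ⟶ y :=
  (λ_ t).inv ≫ D.unit ▷ t ≫ distR y x t ≫ parL y ω ≫ (parRightUnitor y).hom

/-- Transposition `(t ⊗ y ⟶ ⊥) → (t ⟶ x)` along a pairing of `x` and `y`. -/
def rCurry {x y : C} (D : Pairing x y) {t : C} (ω : t ⊗ y ⟶ bot C) : t ⟶ x :=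
  (ρ_ t).inv ≫ t ◁ D.unit ≫ distL t y x ≫ parR ω x ≫ (parLeftUnitor x).hom

/-- The map of right duals induced by a map `f` (the right mate of `f`). -/
def rightMate {x y x' y' : C} (D : Pairing x y) (D' : Pairing x' y') (f : x ⟶ x') : y' ⟶ y :=
  D.lCurry (f ▷ y' ≫ D'.counit)

/-- The map of left duals induced by a map `f` (the left mate of `f`). -/
def leftMate {x y x' y' : C} (D : Pairing x y) (D' : Pairing x' y') (f : y ⟶ y') : x' ⟶ x :=
  D.rCurry (x' ◁ f ≫ D'.counit)

/-- The linear triangle identities. -/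
structure IsDual {x y : C} (D : Pairing x y) : Prop where
  triangle_left : (ρ_ x).inv ≫ x ◁ D.unit ≫ distL x y x ≫ parR D.counit x ≫
    (parLeftUnitor x).hom = 𝟙 x
  triangle_right : (λ_ y).inv ≫ D.unit ▷ y ≫ distR y x y ≫ parL y D.counit ≫
    (parRightUnitor y).hom = 𝟙 y

/-- The pairing of `p ⊗ q` with `q' ⅋ p'` built from pairings of `p` with `p'` and `q` with `q'`. -/
def tensor {p p' q q' : C} (D : Pairing p p') (E : Pairing q q') :
    Pairing (p ⊗ q) (q' ⅋ p') where
  counit := (α_ p q (q' ⅋ p')).hom ≫ p ◁ distL q q' p' ≫ p ◁ parR E.counit p' ≫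
    p ◁ (parLeftUnitor p').hom ≫ D.counit
  unit := E.unit ≫ parL q' (λ_ q).inv ≫ parL q' (D.unit ▷ q) ≫ parL q' (distR p' p q) ≫
    (parAssoc q' p' (p ⊗ q)).inv

/-- The pairing of `p ⅋ q` with `q' ⊗ p'` built from pairings of `p` with `p'` and `q` with `q'`. -/
def par {p p' q q' : C} (D : Pairing p p') (E : Pairing q q') :
    Pairing (p ⅋ q) (q' ⊗ p') where
  counit := (α_ (p ⅋ q) q' p').inv ≫ distR p q q' ▷ p' ≫ parL p E.counit ▷ p' ≫
    (parRightUnitor p).hom ▷ p' ≫ D.counit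
  unit := E.unit ≫ parR (ρ_ q').inv q ≫ parR (q' ◁ D.unit) q ≫ parR (distL q' p' p) q ≫
    (parAssoc (q' ⊗ p') p q).hom

end Pairing

end Duals

/-! ## Star-autonomous categories -/

/-- A (planar) star-autonomous category: a linearly distributive category with a chosen right dual
`perp p` and a chosen left dual `prep p` of every object `p`. -/
class StarAutonomousCategory (C : Type u) [Category.{v} C] [MonoidalCategory.{v} C]
    [ParCategory.{v} C] extends LinearlyDistributiveCategory.{v} C where
  /-- The right dual `p*`. -/
  perp : C → C
  /-- `γ : p ⊗ p* ⟶ ⊥` and `τ : 𝟙 ⟶ p* ⅋ p`. -/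
  perpPairing : ∀ p : C, Pairing p (perp p)
  perpPairing_isDual : ∀ p : C, (perpPairing p).IsDual
  /-- The left dual `*p`. -/
  prep : C → C
  /-- `γ : *p ⊗ p ⟶ ⊥` and `τ : 𝟙 ⟶ p ⅋ *p`. -/
  prepPairing : ∀ p : C, Pairing (prep p) p
  prepPairing_isDual : ∀ p : C, (prepPairing p).IsDual

open StarAutonomousCategory

section Cycles

variable {C : Type u} [Category.{v} C] [MonoidalCategory.{v} C] [ParCategory.{v} C]
  [StarAutonomousCategory.{v} C]

/-- The contravariant action of right duals on arrows. -/
def perpMap {p q : C} (f : p ⟶ q) : perp q ⟶ perp p :=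
  (perpPairing p).rightMate (perpPairing q) f

/-- The contravariant action of left duals on arrows. -/
def prepMap {p q : C} (f : p ⟶ q) : prep q ⟶ prep p :=
  (prepPairing p).leftMate (prepPairing q) f

/-! The canonical de Morgan isomorphisms: comparisons of two duals of the same object. -/

/-- `(p ⊗ q)* ⟶ q* ⅋ p*`. -/
def perpTensor (p q : C) : perp (p ⊗ q) ⟶ perp q ⅋ perp p :=
  ((perpPairing p).tensor (perpPairing q)).rightMate (perpPairing (p ⊗ q)) (𝟙 (p ⊗ q))

/-- `(p ⅋ q)* ⟶ q* ⊗ p*`. -/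
def perpPar (p q : C) : perp (p ⅋ q) ⟶ perp q ⊗ perp p :=
  ((perpPairing p).par (perpPairing q)).rightMate (perpPairing (p ⅋ q)) (𝟙 (p ⅋ q))

/-- `*(p ⊗ q) ⟶ *q ⅋ *p`. -/
def prepTensor (p q : C) : prep (p ⊗ q) ⟶ prep q ⅋ prep p :=
  ((prepPairing q).par (prepPairing p)).leftMate (prepPairing (p ⊗ q)) (𝟙 (p ⊗ q))

/-- `*(p ⅋ q) ⟶ *q ⊗ *p`. -/
def prepPar (p q : C) : prep (p ⅋ q) ⟶ prep q ⊗ prep p :=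
  ((prepPairing q).tensor (prepPairing p)).leftMate (prepPairing (p ⅋ q)) (𝟙 (p ⅋ q))

/-- The family `c` is a natural isomorphism from right duals to left duals. -/
structure IsDualNatIso (c : ∀ p : C, perp p ⟶ prep p) : Prop where
  natural : ∀ {p q : C} (f : p ⟶ q), perpMap f ≫ c p = c q ≫ prepMap f
  isIso : ∀ p : C, IsIso (c p)

/-- `c` is a `⊗`-semicycle: a natural isomorphism compatible with the de Morgan isomorphisms
`(p ⊗ q)* ≅ q* ⅋ p*` and `*(p ⊗ q) ≅ *q ⅋ *p`. -/
structure IsTensorSemicycle (c : ∀ p : C, perp p ⟶ prep p) : Prop extends IsDualNatIso c where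
  tensor : ∀ p q : C, c (p ⊗ q) ≫ prepTensor p q = perpTensor p q ≫ parHom (c q) (c p)

/-- `c` is a `⅋`-semicycle: a natural isomorphism compatible with the de Morgan isomorphisms
`(p ⅋ q)* ≅ q* ⊗ p*` and `*(p ⅋ q) ≅ *q ⊗ *p`. -/
structure IsParSemicycle (c : ∀ p : C, perp p ⟶ prep p) : Prop extends IsDualNatIso c where
  par : ∀ p q : C, c (p ⅋ q) ≫ prepPar p q = perpPar p q ≫ (c q ⊗ₘ c p)

/-- `c` is a cycle (a cyclicity): both a `⊗`-semicycle and a `⅋`-semicycle. -/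
structure IsCycle (c : ∀ p : C, perp p ⟶ prep p) : Prop where
  isTensorSemicycle : IsTensorSemicycle c
  isParSemicycle : IsParSemicycle c

end Cycles

/-! ## Braidings

A braided star-autonomous category is a star-autonomous category with a braiding of `⊗`. -/

section Braided

variable {C : Type u} [Category.{v} C] [MonoidalCategory.{v} C] [ParCategory.{v} C]
  [StarAutonomousCategory.{v} C]
  [BraidedCategory.{v} C]

variable (C) in
/-- The braiding of `⊗` is a symmetry. -/
def TensorBraidingIsSymmetry : Prop :=
  ∀ p q : C, (β_ p q).hom ≫ (β_ q p).hom = 𝟙 (p ⊗ q)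

/-- The braiding of `⅋` induced by duality: `p ⅋ q ⟶ q ⅋ p` is the left mate of the braiding
`p* ⊗ q* ⟶ q* ⊗ p*`, where `q* ⊗ p*` is regarded as the right dual of `p ⅋ q`. -/
def parBraiding (p q : C) : p ⅋ q ⟶ q ⅋ p :=
  ((perpPairing q).par (perpPairing p)).leftMate ((perpPairing p).par (perpPairing q))
    (β_ (perp p) (perp q)).hom

variable (C) in
/-- The induced braiding of `⅋` is a symmetry. -/
def ParBraidingIsSymmetry : Prop :=
  ∀ p q : C, parBraiding p q ≫ parBraiding q p = 𝟙 (p ⅋ q)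

/-- The operation `C(p ⊗ t, ⊥) → C(t ⊗ p, ⊥)` induced by a natural automorphism `θ` of the
identity functor (for instance a balance): braid, apply `θ` to `p`, then apply `ω`. -/
def homCycle (θ : 𝟭 C ≅ 𝟭 C) (p t : C) (ω : p ⊗ t ⟶ bot C) : t ⊗ p ⟶ bot C :=
  (β_ t p).hom ≫ θ.hom.app p ▷ t ≫ ω

/-- The maps `p* ⟶ *p` that correspond to `homCycle θ`: transpose the image of the counit
`p ⊗ p* ⟶ ⊥` (which is itself the transpose of the identity of `p*`). -/
def inducedCycle (θ : 𝟭 C ≅ 𝟭 C) (p : C) : perp p ⟶ prep p :=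
  (prepPairing p).rCurry (homCycle θ p (perp p) (perpPairing p).counit)

end Braided

end StarAut

/-! The counit of a linear dual pair is nondegenerate: a map into `x` or into `y` is determined by
the form obtained by composing it with `x ⊗ y ⟶ ⊥` (`left_ext`, `right_ext`). Hence every equation
between maps into duals can be checked on forms. The composite pairings `D.tensor E` and `D.par E`
are again dual pairs (`IsDual.tensor`, `IsDual.par`), so this applies to the targets of the de
Morgan maps too.

On forms, the cycle at `p` is the braiding followed by the counit (`braidedCycle_counit`). One side
of the tensor square therefore moves `p ⊗ q` around `(p ⊗ q)*` in one step. The other side moves `q`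
and `p` around in turn, and by the hexagons the two differ by exactly the double braiding of `p` and
`q` (`braiding_rotate`). Cancelling the invertible braiding and using nondegeneracy of the counit at
`p ⊗ q`, the square commutes if and only if that double braiding is trivial
(`braidedCycle_tensor_iff`).

In the par square the discrepancy is the double braiding of `q*` and `p*`, which a symmetry kills
(`braidedCycle_par`). The braiding of par is a mate and mates compose, so its square is the mate of
a double braiding of duals. -/

namespace StarAut

open LinearlyDistributiveCategory StarAutonomousCategory

/-! ### Monoidal laws of par -/

section Par

variable {C : Type u} [Category.{v} C] [ParCategory.{v} C]

@[simp]
theorem parL_id (X Y : C) : parL X (𝟙 Y) = 𝟙 (X ⅋ Y) :=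
  @whiskerLeft_id C _ ParCategory.par X Y

@[simp]
theorem parR_id (X Y : C) : parR (𝟙 X) Y = 𝟙 (X ⅋ Y) :=
  @id_whiskerRight C _ ParCategory.par X Y

theorem parL_comp (X : C) {Y Z W : C} (f : Y ⟶ Z) (g : Z ⟶ W) :
    parL X (f ≫ g) = parL X f ≫ parL X g :=
  @MonoidalCategory.whiskerLeft_comp C _ ParCategory.par X Y Z W f g

theorem parR_comp {X Y Z : C} (f : X ⟶ Y) (g : Y ⟶ Z) (W : C) :
    parR (f ≫ g) W = parR f W ≫ parR g W :=
  @MonoidalCategory.comp_whiskerRight C _ ParCategory.par X Y Z f g W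

theorem parHom_eq {X Y X' Y' : C} (f : X ⟶ Y) (g : X' ⟶ Y') :
    parHom f g = parR f X' ≫ parL Y g :=
  @MonoidalCategory.tensorHom_def C _ ParCategory.par X Y X' Y' f g

theorem par_exchange {X Y X' Y' : C} (f : X ⟶ Y) (g : X' ⟶ Y') :
    parL X g ≫ parR f Y' = parR f X' ≫ parL Y g :=
  @MonoidalCategory.whisker_exchange C _ ParCategory.par X Y X' Y' f g

theorem parLeftUnitor_naturality {X Y : C} (f : X ⟶ Y) :
    parL (bot C) f ≫ (parLeftUnitor Y).hom = (parLeftUnitor X).hom ≫ f :=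
  @MonoidalCategory.leftUnitor_naturality C _ ParCategory.par X Y f

theorem parRightUnitor_naturality {X Y : C} (f : X ⟶ Y) :
    parR f (bot C) ≫ (parRightUnitor Y).hom = (parRightUnitor X).hom ≫ f :=
  @MonoidalCategory.rightUnitor_naturality C _ ParCategory.par X Y f

theorem parUnitors_equal :
    (parLeftUnitor (bot C)).hom = (parRightUnitor (bot C)).hom :=
  @MonoidalCategory.unitors_equal C _ ParCategory.par

theorem parAssoc_naturality_left {X X' : C} (f : X ⟶ X') (Y Z : C) :
    parR (parR f Y) Z ≫ (parAssoc X' Y Z).hom = (parAssoc X Y Z).hom ≫ parR f (Y ⅋ Z) :=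
  @MonoidalCategory.associator_naturality_left C _ ParCategory.par X X' f Y Z

theorem parAssoc_naturality_middle (X : C) {Y Y' : C} (f : Y ⟶ Y') (Z : C) :
    parR (parL X f) Z ≫ (parAssoc X Y' Z).hom = (parAssoc X Y Z).hom ≫ parL X (parR f Z) :=
  @MonoidalCategory.associator_naturality_middle C _ ParCategory.par X Y Y' f Z

theorem parAssoc_naturality_right (X Y : C) {Z Z' : C} (f : Z ⟶ Z') :
    parL (X ⅋ Y) f ≫ (parAssoc X Y Z').hom = (parAssoc X Y Z).hom ≫ parL X (parL Y f) :=
  @MonoidalCategory.associator_naturality_right C _ ParCategory.par X Y Z Z' f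

theorem parAssoc_parLeftUnitor (X Y : C) :
    (parAssoc (bot C) X Y).hom ≫ (parLeftUnitor (X ⅋ Y)).hom = parR (parLeftUnitor X).hom Y :=
  (@MonoidalCategory.leftUnitor_whiskerRight C _ ParCategory.par X Y).symm

theorem parAssoc_parRightUnitor (X Y : C) :
    (parAssoc X Y (bot C)).hom ≫ parL X (parRightUnitor Y).hom = (parRightUnitor (X ⅋ Y)).hom :=
  (@MonoidalCategory.rightUnitor_tensor_hom C _ ParCategory.par X Y).symm

theorem parAssoc_triangle (X Y : C) :
    (parAssoc X (bot C) Y).hom ≫ parL X (parLeftUnitor Y).hom = parR (parRightUnitor X).hom Y :=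
  @MonoidalCategory.triangle C _ ParCategory.par X Y

@[simp]
theorem parL_hom_inv (X : C) {Y Z : C} (e : Y ≅ Z) : parL X e.hom ≫ parL X e.inv = 𝟙 _ := by
  rw [← parL_comp, e.hom_inv_id, parL_id]

@[simp]
theorem parR_hom_inv {X Y : C} (e : X ≅ Y) (Z : C) : parR e.hom Z ≫ parR e.inv Z = 𝟙 _ := by
  rw [← parR_comp, e.hom_inv_id, parR_id]

end Par

/-! ### Evaluating forms against one factor of a par -/

section Eval

variable {C : Type u} [Category.{v} C] [MonoidalCategory.{v} C] [ParCategory.{v} C]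
  [LinearlyDistributiveCategory.{v} C]

/-- Evaluation of a form against the left factor of a par. -/
def leftEval {B p : C} (a : B ⊗ p ⟶ bot C) (q : C) : B ⊗ (p ⅋ q) ⟶ q :=
  distL B p q ≫ parR a q ≫ (parLeftUnitor q).hom

/-- Evaluation of a form against the right factor of a par. -/
def rightEval (p : C) {q A : C} (b : q ⊗ A ⟶ bot C) : (p ⅋ q) ⊗ A ⟶ p :=
  distR p q A ≫ parL p b ≫ (parRightUnitor p).hom

theorem leftEval_naturality {B p q q' : C} (a : B ⊗ p ⟶ bot C) (h : q ⟶ q') :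
    B ◁ parL p h ≫ leftEval a q' = leftEval a q ≫ h := by
  simp only [leftEval, Category.assoc, ← parLeftUnitor_naturality]
  rw [reassoc_of% distL_natural₃ B p h, reassoc_of% par_exchange a h]

theorem rightEval_naturality {p p' q A : C} (h : p ⟶ p') (b : q ⊗ A ⟶ bot C) :
    parR h q ▷ A ≫ rightEval p' b = rightEval p b ≫ h := by
  simp only [rightEval, Category.assoc, ← parRightUnitor_naturality]
  rw [reassoc_of% distR_natural₁ h q A, reassoc_of% par_exchange h b]

theorem whiskerRight_leftEval {B B' p : C} (g : B ⟶ B') (a : B' ⊗ p ⟶ bot C) (q : C) :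
    g ▷ (p ⅋ q) ≫ leftEval a q = leftEval (g ▷ p ≫ a) q := by
  simp only [leftEval, parR_comp, Category.assoc]
  rw [reassoc_of% distL_natural₁ g p q]

theorem parR_leftEval {B p p' : C} (g : p ⟶ p') (a : B ⊗ p' ⟶ bot C) (q : C) :
    B ◁ parR g q ≫ leftEval a q = leftEval (B ◁ g ≫ a) q := by
  simp only [leftEval, parR_comp, Category.assoc]
  rw [reassoc_of% distL_natural₂ B g q]

theorem parL_rightEval (p : C) {q q' A : C} (g : q ⟶ q') (b : q' ⊗ A ⟶ bot C) :
    parL p g ▷ A ≫ rightEval p b = rightEval p (g ▷ A ≫ b) := by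
  simp only [rightEval, parL_comp, Category.assoc]
  rw [reassoc_of% distR_natural₂ p g A]

theorem leftEval_bot {B p : C} (a : B ⊗ p ⟶ bot C) :
    leftEval a (bot C) = B ◁ (parRightUnitor p).hom ≫ a := by
  rw [leftEval, parUnitors_equal, parRightUnitor_naturality, reassoc_of% distL_parRightUnitor B p]

theorem rightEval_bot {q A : C} (b : q ⊗ A ⟶ bot C) :
    rightEval (bot C) b = (parLeftUnitor q).hom ▷ A ≫ b := by
  rw [rightEval, ← parUnitors_equal, parLeftUnitor_naturality,
    reassoc_of% distR_parLeftUnitor q A]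

/-- Evaluating a par on both sides does not depend on the order. -/
theorem whiskerLeft_rightEval_comp {A B p q : C} (a : B ⊗ p ⟶ bot C) (b : q ⊗ A ⟶ bot C) :
    (α_ B (p ⅋ q) A).hom ≫ B ◁ rightEval p b ≫ a = leftEval a q ▷ A ≫ b := by
  -- The form `a` is itself an evaluation, at `⊥`, up to a unitor. Naturality of `leftEval` then
  -- lets `b` be applied last.
  have h : B ◁ rightEval p b ≫ a =
      B ◁ distR p q A ≫ leftEval a (q ⊗ A) ≫ b := by
    rw [← leftEval_naturality, leftEval_bot]
    simp [rightEval]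
  rw [h]
  simp only [leftEval, Category.assoc, comp_whiskerRight]
  rw [← reassoc_of% distL_distR B p q A, ← reassoc_of% distR_natural₁ a q A,
    reassoc_of% distR_parLeftUnitor q A]

/-- The form here is the counit of a tensor of pairings. Evaluating it amounts to evaluating `e` and
then `d`, which reduces the composite pairing to its two components. -/
theorem leftEval_tensor {p q q' p' : C} (d : p ⊗ p' ⟶ bot C) (e : q ⊗ q' ⟶ bot C) (z : C) :
    leftEval ((α_ p q (q' ⅋ p')).hom ≫ p ◁ leftEval e p' ≫ d) z =
      (α_ p q _).hom ≫ p ◁ (q ◁ (parAssoc q' p' z).hom ≫ leftEval e (p' ⅋ z)) ≫ leftEval d z := by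
  have h : q ◁ (parAssoc q' p' z).hom ≫ leftEval e (p' ⅋ z) =
      distL q (q' ⅋ p') z ≫ parR (leftEval e p') z := by
    simp only [leftEval, parR_comp]
    rw [← reassoc_of% distL_parAssoc q q' p' z, ← reassoc_of% parAssoc_naturality_left,
      parAssoc_parLeftUnitor]
  rw [h, MonoidalCategory.whiskerLeft_comp, Category.assoc, parR_leftEval]
  simp only [leftEval, parR_comp, Category.assoc]
  rw [reassoc_of% distL_associator p q (q' ⅋ p') z]

theorem rightEval_par {p q q' p' : C} (d : p ⊗ p' ⟶ bot C) (e : q ⊗ q' ⟶ bot C) (z : C) :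
    rightEval z ((α_ (p ⅋ q) q' p').inv ≫ rightEval p e ▷ p' ≫ d) =
      (α_ _ q' p').inv ≫ ((parAssoc z p q).inv ▷ q' ≫ rightEval (z ⅋ p) e) ▷ p' ≫
        rightEval z d := by
  have h : (parAssoc z p q).inv ▷ q' ≫ rightEval (z ⅋ p) e =
      distR z (p ⅋ q) q' ≫ parL z (rightEval p e) := by
    rw [← cancel_epi ((parAssoc z p q).hom ▷ q'), hom_inv_whiskerRight_assoc]
    simp only [rightEval, parL_comp]
    rw [← reassoc_of% distR_parAssoc z p q q', ← reassoc_of% parAssoc_naturality_right,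
      parAssoc_parRightUnitor]
  rw [h, MonoidalCategory.comp_whiskerRight, Category.assoc, parL_rightEval]
  rw [← cancel_epi (α_ (z ⅋ (p ⅋ q)) q' p').hom]
  simp only [rightEval, parL_comp, Iso.hom_inv_id_assoc]
  rw [← reassoc_of% distR_associator z (p ⅋ q) q' p']
  simp only [Category.assoc]
  rw [reassoc_of% parL_hom_inv z (α_ (p ⅋ q) q' p')]

end Eval

/-! ### Transposition, nondegeneracy, mates and composite dual pairs -/

section Duals

variable {C : Type u} [Category.{v} C] [MonoidalCategory.{v} C] [ParCategory.{v} C]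
  [LinearlyDistributiveCategory.{v} C]

namespace Pairing

variable {x y : C} (D : Pairing x y)

/-- Transposition `(x ⊗ t ⟶ z) → (t ⟶ y ⅋ z)`. -/
def lTranspose {t z : C} (ω : x ⊗ t ⟶ z) : t ⟶ y ⅋ z :=
  (λ_ t).inv ≫ D.unit ▷ t ≫ distR y x t ≫ parL y ω

/-- Transposition `(t ⊗ y ⟶ z) → (t ⟶ z ⅋ x)`. -/
def rTranspose {t z : C} (ω : t ⊗ y ⟶ z) : t ⟶ z ⅋ x :=
  (ρ_ t).inv ≫ t ◁ D.unit ≫ distL t y x ≫ parR ω x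

theorem lCurry_eq {t : C} (ω : x ⊗ t ⟶ bot C) :
    D.lCurry ω = D.lTranspose ω ≫ (parRightUnitor y).hom := by
  simp [lCurry, lTranspose]

theorem rCurry_eq {t : C} (ω : t ⊗ y ⟶ bot C) :
    D.rCurry ω = D.rTranspose ω ≫ (parLeftUnitor x).hom := by
  simp [rCurry, rTranspose]

theorem comp_lTranspose {s t z : C} (g : s ⟶ t) (ω : x ⊗ t ⟶ z) :
    g ≫ D.lTranspose ω = D.lTranspose (x ◁ g ≫ ω) := by
  simp only [lTranspose, parL_comp]
  rw [← reassoc_of% distR_natural₃ y x g, leftUnitor_inv_naturality_assoc,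
    whisker_exchange_assoc]

theorem comp_rTranspose {s t z : C} (g : s ⟶ t) (ω : t ⊗ y ⟶ z) :
    g ≫ D.rTranspose ω = D.rTranspose (g ▷ y ≫ ω) := by
  simp only [rTranspose, parR_comp]
  rw [← reassoc_of% distL_natural₁ g y x, rightUnitor_inv_naturality_assoc,
    ← whisker_exchange_assoc]

theorem lTranspose_comp {t z w : C} (ω : x ⊗ t ⟶ z) (h : z ⟶ w) :
    D.lTranspose (ω ≫ h) = D.lTranspose ω ≫ parL y h := by
  simp [lTranspose, parL_comp]

theorem rTranspose_comp {t z w : C} (ω : t ⊗ y ⟶ z) (h : z ⟶ w) :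
    D.rTranspose (ω ≫ h) = D.rTranspose ω ≫ parR h x := by
  simp [rTranspose, parR_comp]

theorem comp_lCurry {s t : C} (g : s ⟶ t) (ω : x ⊗ t ⟶ bot C) :
    g ≫ D.lCurry ω = D.lCurry (x ◁ g ≫ ω) := by
  rw [lCurry_eq, lCurry_eq, ← comp_lTranspose, Category.assoc]

theorem comp_rCurry {s t : C} (g : s ⟶ t) (ω : t ⊗ y ⟶ bot C) :
    g ≫ D.rCurry ω = D.rCurry (g ▷ y ≫ ω) := by
  rw [rCurry_eq, rCurry_eq, ← comp_rTranspose, Category.assoc]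

/-- By `distL_distR` the evaluation slides past `t`, which isolates one zigzag of the pairing. The
triangle identity is not assumed, so that it can be supplied separately. -/
theorem whiskerLeft_unit_leftEval_of_lTranspose {t z : C} (ω : x ⊗ t ⟶ z) :
    x ◁ D.lTranspose ω ≫ leftEval D.counit z =
      ((ρ_ x).inv ≫ x ◁ D.unit ≫ leftEval D.counit x) ▷ t ≫ ω := by
  simp only [lTranspose, MonoidalCategory.whiskerLeft_comp, Category.assoc, leftEval_naturality]
  have h : x ◁ distR y x t ≫ leftEval D.counit (x ⊗ t) =
      (α_ x (y ⅋ x) t).inv ≫ leftEval D.counit x ▷ t := by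
    rw [Iso.eq_inv_comp]
    simp only [leftEval, comp_whiskerRight]
    rw [← reassoc_of% distL_distR x y x t, ← reassoc_of% distR_natural₁ D.counit x t,
      distR_parLeftUnitor x t]
  rw [reassoc_of% h]
  simp

theorem whiskerRight_unit_rightEval_of_rTranspose {t z : C} (ω : t ⊗ y ⟶ z) :
    D.rTranspose ω ▷ y ≫ rightEval z D.counit =
      t ◁ ((λ_ y).inv ≫ D.unit ▷ y ≫ rightEval y D.counit) ≫ ω := by
  simp only [rTranspose, comp_whiskerRight, Category.assoc, rightEval_naturality]
  have h : distL t y x ▷ y ≫ rightEval (t ⊗ y) D.counit =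
      (α_ t (y ⅋ x) y).hom ≫ t ◁ rightEval y D.counit := by
    simp only [rightEval, MonoidalCategory.whiskerLeft_comp]
    rw [reassoc_of% distL_distR t y x y, ← distL_parRightUnitor t y,
      reassoc_of% distL_natural₃ t y D.counit]
  rw [reassoc_of% h]
  simp

/-- Here `distR_distL` isolates the other zigzag. When that one is trivial, evaluation has a left
inverse, which gives `leftEval_ext`. -/
theorem lTranspose_leftEval (z : C) :
    D.lTranspose (leftEval D.counit z) =
      parR ((λ_ y).inv ≫ D.unit ▷ y ≫ rightEval y D.counit) z := by
  simp only [lTranspose, leftEval, rightEval, parL_comp, parR_comp]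
  rw [reassoc_of% distR_distL y x y z, reassoc_of% distL_natural₁ D.unit y z,
    ← reassoc_of% parAssoc_naturality_middle, parAssoc_triangle]
  have h : (λ_ (y ⅋ z)).inv ≫ distL (𝟙_ C) y z = parR (λ_ y).inv z := by
    rw [Iso.inv_comp_eq, ← distL_leftUnitor, Category.assoc, parR_hom_inv, Category.comp_id]
  rw [reassoc_of% h]

theorem rTranspose_rightEval (z : C) :
    D.rTranspose (rightEval z D.counit) =
      parL z ((ρ_ x).inv ≫ x ◁ D.unit ≫ leftEval D.counit x) := by
  simp only [rTranspose, leftEval, rightEval, parL_comp, parR_comp]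
  have e := distR_distL z x y x
  rw [← cancel_mono (parAssoc z (x ⊗ y) x).inv] at e
  simp only [Category.assoc, Iso.hom_inv_id, Category.comp_id] at e
  have e' : parR (parL z D.counit) x =
      (parAssoc z (x ⊗ y) x).hom ≫ parL z (parR D.counit x) ≫ (parAssoc z (bot C) x).inv := by
    rw [← reassoc_of% parAssoc_naturality_middle, Iso.hom_inv_id, Category.comp_id]
  rw [← reassoc_of% e, e', ← parAssoc_triangle]
  simp only [Category.assoc, Iso.inv_hom_id_assoc]
  rw [reassoc_of% distR_natural₃ z x D.unit]
  have h : (ρ_ (z ⅋ x)).inv ≫ distR z x (𝟙_ C) = parL z (ρ_ x).inv := by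
    rw [Iso.inv_comp_eq, ← distR_rightUnitor, Category.assoc, parL_hom_inv, Category.comp_id]
  rw [reassoc_of% h]

variable {D}

/-- A single triangle identity is assumed in place of `IsDual`: `IsDual.tensor` derives the second
triangle from the first and needs this form of the result. -/
theorem leftEval_lTranspose (hD : (ρ_ x).inv ≫ x ◁ D.unit ≫ leftEval D.counit x = 𝟙 x)
    {t z : C} (ω : x ⊗ t ⟶ z) : x ◁ D.lTranspose ω ≫ leftEval D.counit z = ω := by
  rw [whiskerLeft_unit_leftEval_of_lTranspose, hD, id_whiskerRight, Category.id_comp]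

theorem rightEval_rTranspose (hD : (λ_ y).inv ≫ D.unit ▷ y ≫ rightEval y D.counit = 𝟙 y)
    {t z : C} (ω : t ⊗ y ⟶ z) : D.rTranspose ω ▷ y ≫ rightEval z D.counit = ω := by
  rw [whiskerRight_unit_rightEval_of_rTranspose, hD, MonoidalCategory.whiskerLeft_id,
    Category.id_comp]

theorem whiskerLeft_lCurry (hD : (ρ_ x).inv ≫ x ◁ D.unit ≫ leftEval D.counit x = 𝟙 x)
    {t : C} (ω : x ⊗ t ⟶ bot C) : x ◁ D.lCurry ω ≫ D.counit = ω := by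
  rw [lCurry_eq, MonoidalCategory.whiskerLeft_comp, Category.assoc, ← leftEval_bot,
    leftEval_lTranspose hD]

theorem whiskerRight_rCurry (hD : (λ_ y).inv ≫ D.unit ▷ y ≫ rightEval y D.counit = 𝟙 y)
    {t : C} (ω : t ⊗ y ⟶ bot C) : D.rCurry ω ▷ y ≫ D.counit = ω := by
  rw [rCurry_eq, comp_whiskerRight, Category.assoc, ← rightEval_bot,
    rightEval_rTranspose hD]

theorem IsDual.leftEval_ext (hD : D.IsDual) {t z : C} {f g : t ⟶ y ⅋ z}
    (h : x ◁ f ≫ leftEval D.counit z = x ◁ g ≫ leftEval D.counit z) : f = g := by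
  have e : D.lTranspose (leftEval D.counit z) = 𝟙 _ := by
    rw [lTranspose_leftEval, rightEval, hD.triangle_right, parR_id]
  rw [← Category.comp_id f, ← Category.comp_id g, ← e, comp_lTranspose, comp_lTranspose, h]

theorem IsDual.rightEval_ext (hD : D.IsDual) {t z : C} {f g : t ⟶ z ⅋ x}
    (h : f ▷ y ≫ rightEval z D.counit = g ▷ y ≫ rightEval z D.counit) : f = g := by
  have e : D.rTranspose (rightEval z D.counit) = 𝟙 _ := by
    rw [rTranspose_rightEval, leftEval, hD.triangle_left, parL_id]
  rw [← Category.comp_id f, ← Category.comp_id g, ← e, comp_rTranspose, comp_rTranspose, h]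

theorem IsDual.lCurry_counit (hD : D.IsDual) : D.lCurry D.counit = 𝟙 y := hD.triangle_right

theorem IsDual.rCurry_counit (hD : D.IsDual) : D.rCurry D.counit = 𝟙 x := hD.triangle_left

theorem IsDual.left_ext (hD : D.IsDual) {t : C} {f g : t ⟶ x}
    (h : f ▷ y ≫ D.counit = g ▷ y ≫ D.counit) : f = g := by
  rw [← Category.comp_id f, ← Category.comp_id g, ← hD.rCurry_counit, comp_rCurry, comp_rCurry, h]

theorem IsDual.right_ext (hD : D.IsDual) {t : C} {f g : t ⟶ y}
    (h : x ◁ f ≫ D.counit = x ◁ g ≫ D.counit) : f = g := by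
  rw [← Category.comp_id f, ← Category.comp_id g, ← hD.lCurry_counit, comp_lCurry, comp_lCurry, h]

theorem IsDual.whiskerLeft_rightMate (hD : D.IsDual) {x' y' : C} (D' : Pairing x' y')
    (f : x ⟶ x') : x ◁ D.rightMate D' f ≫ D.counit = f ▷ y' ≫ D'.counit :=
  Pairing.whiskerLeft_lCurry hD.triangle_left _

theorem IsDual.whiskerRight_leftMate (hD : D.IsDual) {x' y' : C} (D' : Pairing x' y')
    (f : y ⟶ y') : D.leftMate D' f ▷ y ≫ D.counit = x' ◁ f ≫ D'.counit :=
  Pairing.whiskerRight_rCurry hD.triangle_right _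

theorem IsDual.leftMate_id (hD : D.IsDual) : D.leftMate D (𝟙 y) = 𝟙 x := by
  simp [leftMate, hD.rCurry_counit]

theorem IsDual.leftMate_comp (hD : D.IsDual) {x' y' x'' y'' : C} {D' : Pairing x' y'}
    (hD' : D'.IsDual) (D'' : Pairing x'' y'') (f : y ⟶ y') (g : y' ⟶ y'') :
    D'.leftMate D'' g ≫ D.leftMate D' f = D.leftMate D'' (f ≫ g) := by
  apply hD.left_ext
  rw [comp_whiskerRight, Category.assoc, hD.whiskerRight_leftMate, ← whisker_exchange_assoc,
    hD'.whiskerRight_leftMate, hD.whiskerRight_leftMate, MonoidalCategory.whiskerLeft_comp,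
    Category.assoc]

section Composite

variable {p p' q q' : C} (D : Pairing p p') (E : Pairing q q')

theorem tensor_counit :
    (D.tensor E).counit = (α_ p q (q' ⅋ p')).hom ≫ p ◁ leftEval E.counit p' ≫ D.counit := by
  simp [tensor, leftEval]

theorem par_counit :
    (D.par E).counit = (α_ (p ⅋ q) q' p').inv ≫ rightEval p E.counit ▷ p' ≫ D.counit := by
  simp [par, rightEval]

/-- As an iterated transpose, the unit cancels against the iterated evaluation of `leftEval_tensor`.
-/
theorem tensor_unit :
    (D.tensor E).unit = E.lTranspose ((ρ_ q).hom ≫ D.lTranspose (𝟙 (p ⊗ q))) ≫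
      (parAssoc q' p' (p ⊗ q)).inv := by
  have h : E.unit = E.lTranspose (ρ_ q).hom := by
    have h' := distR_rightUnitor q' q
    simp [lTranspose, h', unitors_inv_equal]
  rw [lTranspose_comp, ← h]
  simp [tensor, lTranspose, parL_comp]

theorem par_unit :
    (D.par E).unit = E.rTranspose ((λ_ q').hom ≫ D.rTranspose (𝟙 (q' ⊗ p'))) ≫
      (parAssoc (q' ⊗ p') p q).hom := by
  have h : E.unit = E.rTranspose (λ_ q').hom := by
    have h' := distL_leftUnitor q' q
    simp [rTranspose, h', unitors_equal]
  rw [rTranspose_comp, ← h]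
  simp [par, rTranspose, parR_comp]

variable {D E}

theorem IsDual.tensor (hD : D.IsDual) (hE : E.IsDual) : (D.tensor E).IsDual := by
  have h : (ρ_ _).inv ≫ (p ⊗ q) ◁ (D.tensor E).unit ≫ leftEval (D.tensor E).counit (p ⊗ q) =
      𝟙 _ := by
    rw [tensor_counit, leftEval_tensor, tensor_unit]
    have e : q ◁ (E.lTranspose ((ρ_ q).hom ≫ D.lTranspose (𝟙 (p ⊗ q))) ≫
        (parAssoc q' p' (p ⊗ q)).inv) ≫ q ◁ (parAssoc q' p' (p ⊗ q)).hom ≫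
          leftEval E.counit (p' ⅋ (p ⊗ q)) = (ρ_ q).hom ≫ D.lTranspose (𝟙 (p ⊗ q)) := by
      rw [MonoidalCategory.whiskerLeft_comp, Category.assoc, whiskerLeft_inv_hom_assoc,
        leftEval_lTranspose hE.triangle_left]
    rw [associator_naturality_right_assoc, ← MonoidalCategory.whiskerLeft_comp_assoc, e,
      MonoidalCategory.whiskerLeft_comp, Category.assoc, leftEval_lTranspose hD.triangle_left]
    simp
  refine ⟨h, ?_⟩
  -- The second triangle needs no diagram chase: the composite counit evaluates along `E` and then
  -- `D`, both injectively, and by `h` the two sides of the triangle induce the same form.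
  have inj : ∀ {t : C} {f g : t ⟶ q' ⅋ p'},
      (p ⊗ q) ◁ f ≫ (D.tensor E).counit = (p ⊗ q) ◁ g ≫ (D.tensor E).counit → f = g := by
    intro t f g hfg
    apply hE.leftEval_ext
    apply hD.right_ext
    simpa [tensor_counit] using hfg
  apply inj
  rw [MonoidalCategory.whiskerLeft_id, Category.id_comp]
  exact whiskerLeft_lCurry h _

theorem IsDual.par (hD : D.IsDual) (hE : E.IsDual) : (D.par E).IsDual := by
  have h : (λ_ _).inv ≫ (D.par E).unit ▷ (q' ⊗ p') ≫ rightEval (q' ⊗ p') (D.par E).counit =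
      𝟙 _ := by
    rw [par_counit, rightEval_par, par_unit]
    have e : (E.rTranspose ((λ_ q').hom ≫ D.rTranspose (𝟙 (q' ⊗ p'))) ≫
        (parAssoc (q' ⊗ p') p q).hom) ▷ q' ≫ (parAssoc (q' ⊗ p') p q).inv ▷ q' ≫
          rightEval ((q' ⊗ p') ⅋ p) E.counit = (λ_ q').hom ≫ D.rTranspose (𝟙 (q' ⊗ p')) := by
      rw [MonoidalCategory.comp_whiskerRight, Category.assoc, hom_inv_whiskerRight_assoc,
        rightEval_rTranspose hE.triangle_right]
    rw [associator_inv_naturality_left_assoc, ← MonoidalCategory.comp_whiskerRight_assoc, e,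
      MonoidalCategory.comp_whiskerRight, Category.assoc, rightEval_rTranspose hD.triangle_right]
    simp
  refine ⟨?_, h⟩
  have inj : ∀ {t : C} {f g : t ⟶ p ⅋ q},
      f ▷ (q' ⊗ p') ≫ (D.par E).counit = g ▷ (q' ⊗ p') ≫ (D.par E).counit → f = g := by
    intro t f g hfg
    apply hE.rightEval_ext
    apply hD.left_ext
    simpa [par_counit] using hfg
  apply inj
  rw [id_whiskerRight, Category.id_comp]
  exact whiskerRight_rCurry h _

end Composite

end Pairing

end Duals

/-! ### Double braidings from the hexagons -/

section BraidedMonoidal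

variable {C : Type u} [Category.{v} C] [MonoidalCategory.{v} C] [BraidedCategory.{v} C]

/-- Moving two objects around a third one in two steps differs from moving their product in one
step by a double braiding. -/
theorem braiding_rotate (t p q : C) :
    (α_ t p q).inv ≫ (β_ (t ⊗ p) q).hom ≫ (α_ q t p).inv ≫ (β_ (q ⊗ t) p).hom ≫
        (α_ p q t).inv =
      t ◁ ((β_ p q).hom ≫ (β_ q p).hom) ≫ (β_ t (p ⊗ q)).hom := by
  -- Naturality carries the second braiding past `t`. The hexagons then split both sides into the
  -- same elementary crossings.
  rw [MonoidalCategory.whiskerLeft_comp, Category.assoc, BraidedCategory.braiding_naturality_right,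
    BraidedCategory.braiding_tensor_left_hom t p q, BraidedCategory.braiding_tensor_right_hom t q p,
    BraidedCategory.braiding_tensor_left_hom q t p]
  simp

theorem braiding_rotate_symm (a b t : C) :
    (α_ a b t).hom ≫ (β_ a (b ⊗ t)).hom ≫ (α_ b t a).hom ≫ (β_ b (t ⊗ a)).hom ≫
        (α_ t a b).hom =
      ((β_ a b).hom ≫ (β_ b a).hom) ▷ t ≫ (β_ (a ⊗ b) t).hom := by
  rw [MonoidalCategory.comp_whiskerRight, Category.assoc, BraidedCategory.braiding_naturality_left,
    BraidedCategory.braiding_tensor_right_hom a b t, BraidedCategory.braiding_tensor_left_hom b a t,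
    BraidedCategory.braiding_tensor_right_hom b t a]
  simp

end BraidedMonoidal

/-! ### De Morgan maps transport counits -/

section DeMorgan

variable {C : Type u} [Category.{v} C] [MonoidalCategory.{v} C] [ParCategory.{v} C]
  [StarAutonomousCategory.{v} C]

theorem whiskerLeft_perpTensor_counit (p q : C) :
    (p ⊗ q) ◁ perpTensor p q ≫ ((perpPairing p).tensor (perpPairing q)).counit =
      (perpPairing (p ⊗ q)).counit := by
  rw [perpTensor, (Pairing.IsDual.tensor (perpPairing_isDual p)
    (perpPairing_isDual q)).whiskerLeft_rightMate, id_whiskerRight, Category.id_comp]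

theorem whiskerLeft_perpPar_counit (p q : C) :
    (p ⅋ q) ◁ perpPar p q ≫ ((perpPairing p).par (perpPairing q)).counit =
      (perpPairing (p ⅋ q)).counit := by
  rw [perpPar, (Pairing.IsDual.par (perpPairing_isDual p)
    (perpPairing_isDual q)).whiskerLeft_rightMate, id_whiskerRight, Category.id_comp]

theorem whiskerRight_prepTensor_counit (p q : C) :
    prepTensor p q ▷ (p ⊗ q) ≫ ((prepPairing q).par (prepPairing p)).counit =
      (prepPairing (p ⊗ q)).counit := by
  rw [prepTensor, (Pairing.IsDual.par (prepPairing_isDual q)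
    (prepPairing_isDual p)).whiskerRight_leftMate, MonoidalCategory.whiskerLeft_id,
    Category.id_comp]

theorem whiskerRight_prepPar_counit (p q : C) :
    prepPar p q ▷ (p ⅋ q) ≫ ((prepPairing q).tensor (prepPairing p)).counit =
      (prepPairing (p ⅋ q)).counit := by
  rw [prepPar, (Pairing.IsDual.tensor (prepPairing_isDual q)
    (prepPairing_isDual p)).whiskerRight_leftMate, MonoidalCategory.whiskerLeft_id,
    Category.id_comp]

end DeMorgan

/-! ### The cycle squares on forms -/

section Cycle

variable {C : Type u} [Category.{v} C] [MonoidalCategory.{v} C] [ParCategory.{v} C]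
  [StarAutonomousCategory.{v} C] [BraidedCategory.{v} C]

/-- The maps `p* ⟶ *p` obtained by braiding the counits. -/
abbrev braidedCycle (p : C) : perp p ⟶ prep p := inducedCycle (Iso.refl (𝟭 C)) p

theorem braidedCycle_counit (p : C) :
    braidedCycle p ▷ p ≫ (prepPairing p).counit =
      (β_ (perp p) p).hom ≫ (perpPairing p).counit := by
  rw [braidedCycle, inducedCycle,
    Pairing.whiskerRight_rCurry (prepPairing_isDual p).triangle_right]
  simp [homCycle]

theorem braidedCycle_natural {p q : C} (f : p ⟶ q) :
    perpMap f ≫ braidedCycle p = braidedCycle q ≫ prepMap f := by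
  apply (prepPairing_isDual p).left_ext
  rw [comp_whiskerRight, comp_whiskerRight, Category.assoc, Category.assoc, braidedCycle_counit,
    prepMap, (prepPairing_isDual p).whiskerRight_leftMate, ← whisker_exchange_assoc,
    braidedCycle_counit, BraidedCategory.braiding_naturality_left_assoc, perpMap,
    (perpPairing_isDual p).whiskerLeft_rightMate, BraidedCategory.braiding_naturality_right_assoc]

theorem braidedCycle_isIso (p : C) : IsIso (braidedCycle p) := by
  -- The inverse transposes the other counit along the inverse braiding.
  let g : prep p ⟶ perp p :=
    (perpPairing p).lCurry ((β_ (prep p) p).inv ≫ (prepPairing p).counit)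
  have hg : p ◁ g ≫ (perpPairing p).counit = (β_ (prep p) p).inv ≫ (prepPairing p).counit :=
    Pairing.whiskerLeft_lCurry (perpPairing_isDual p).triangle_left _
  refine ⟨g, ?_, ?_⟩
  · apply (perpPairing_isDual p).right_ext
    rw [MonoidalCategory.whiskerLeft_comp, Category.assoc, hg,
      BraidedCategory.braiding_inv_naturality_right_assoc, braidedCycle_counit]
    simp
  · apply (prepPairing_isDual p).left_ext
    rw [comp_whiskerRight, Category.assoc, braidedCycle_counit,
      BraidedCategory.braiding_naturality_left_assoc, hg]
    simp

theorem braidedCycle_isDualNatIso : IsDualNatIso (braidedCycle (C := C)) :=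
  ⟨braidedCycle_natural, braidedCycle_isIso⟩

/-- The pairing of left duals consumes `p` and then `q`, each through its own braiding;
`braiding_rotate` merges these into one braiding at the cost of a double braiding. -/
theorem parHom_braidedCycle_counit (p q : C) :
    parHom (braidedCycle q) (braidedCycle p) ▷ (p ⊗ q) ≫
        ((prepPairing q).par (prepPairing p)).counit =
      (perp q ⅋ perp p) ◁ ((β_ p q).hom ≫ (β_ q p).hom) ≫ (β_ _ _).hom ≫
        ((perpPairing p).tensor (perpPairing q)).counit := by
  have h : parHom (braidedCycle q) (braidedCycle p) ▷ p ≫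
      rightEval (prep q) (prepPairing p).counit =
        rightEval (perp q) ((β_ (perp p) p).hom ≫ (perpPairing p).counit) ≫ braidedCycle q := by
    rw [parHom_eq, comp_whiskerRight, Category.assoc, parL_rightEval, rightEval_naturality,
      braidedCycle_counit]
  rw [Pairing.par_counit, associator_inv_naturality_left_assoc, ← comp_whiskerRight_assoc, h,
    comp_whiskerRight, Category.assoc, braidedCycle_counit,
    BraidedCategory.braiding_naturality_left_assoc, ← Category.assoc (_ ◁ _),
    ← braiding_rotate, Pairing.tensor_counit]
  -- The pairing of right duals consumes `q` before `p`, so the two evaluations have to be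
  -- interchanged.
  have e := whiskerLeft_rightEval_comp (perpPairing q).counit
    ((β_ (perp p) p).hom ≫ (perpPairing p).counit)
  rw [← cancel_epi (α_ q (perp q ⅋ perp p) p).inv, Iso.inv_hom_id_assoc] at e
  simp only [e, Category.assoc, Iso.inv_hom_id_assoc,
    BraidedCategory.braiding_naturality_left_assoc]

/-- Dual to `parHom_braidedCycle_counit`: now the dual objects travel around `p ⅋ q` one at a time,
so the double braiding is between `perp q` and `perp p`. -/
theorem tensorHom_braidedCycle_counit (p q : C) :
    (braidedCycle q ⊗ₘ braidedCycle p) ▷ (p ⅋ q) ≫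
        ((prepPairing q).tensor (prepPairing p)).counit =
      ((β_ (perp q) (perp p)).hom ≫ (β_ (perp p) (perp q)).hom) ▷ (p ⅋ q) ≫ (β_ _ _).hom ≫
        ((perpPairing p).par (perpPairing q)).counit := by
  have h : (braidedCycle q ⊗ₘ braidedCycle p) ▷ (p ⅋ q) ≫
      (α_ _ _ _).hom ≫ prep q ◁ leftEval (prepPairing p).counit q =
        (α_ _ _ _).hom ≫
          perp q ◁ leftEval ((β_ (perp p) p).hom ≫ (perpPairing p).counit) q ≫
            braidedCycle q ▷ q := by
    rw [← braidedCycle_counit, ← whiskerRight_leftEval, whisker_exchange,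
      MonoidalCategory.tensorHom_def]
    simp
  rw [Pairing.tensor_counit, reassoc_of% h, braidedCycle_counit,
    BraidedCategory.braiding_naturality_right_assoc, ← Category.assoc (_ ▷ _),
    ← braiding_rotate_symm, Pairing.par_counit]
  have e := whiskerLeft_rightEval_comp
    ((β_ (perp p) p).hom ≫ (perpPairing p).counit) (perpPairing q).counit
  simp only [← e, Category.assoc, Iso.hom_inv_id_assoc,
    BraidedCategory.braiding_naturality_right_assoc]

theorem braidedCycle_tensor_iff (p q : C) :
    braidedCycle (p ⊗ q) ≫ prepTensor p q =
        perpTensor p q ≫ parHom (braidedCycle q) (braidedCycle p) ↔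
      (β_ p q).hom ≫ (β_ q p).hom = 𝟙 (p ⊗ q) := by
  have hl : (braidedCycle (p ⊗ q) ≫ prepTensor p q) ▷ (p ⊗ q) ≫
      ((prepPairing q).par (prepPairing p)).counit =
        (β_ _ _).hom ≫ (perpPairing (p ⊗ q)).counit := by
    rw [comp_whiskerRight, Category.assoc, whiskerRight_prepTensor_counit, braidedCycle_counit]
  have hr : (perpTensor p q ≫ parHom (braidedCycle q) (braidedCycle p)) ▷ (p ⊗ q) ≫
      ((prepPairing q).par (prepPairing p)).counit =
        (β_ _ _).hom ≫ ((β_ p q).hom ≫ (β_ q p).hom) ▷ _ ≫ (perpPairing (p ⊗ q)).counit := by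
    rw [comp_whiskerRight, Category.assoc, parHom_braidedCycle_counit, ← whisker_exchange_assoc,
      BraidedCategory.braiding_naturality_left_assoc, whiskerLeft_perpTensor_counit,
      BraidedCategory.braiding_naturality_right_assoc]
  constructor
  · intro h
    -- Once the common braiding is cancelled, the double braiding and the identity induce the same
    -- form against `(p ⊗ q)*`.
    rw [h, hr, cancel_epi] at hl
    apply (perpPairing_isDual (p ⊗ q)).left_ext
    rw [hl, id_whiskerRight, Category.id_comp]
  · intro h
    apply (Pairing.IsDual.par (prepPairing_isDual q) (prepPairing_isDual p)).left_ext
    rw [hl, hr, h, id_whiskerRight, Category.id_comp]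

theorem braidedCycle_par {p q : C}
    (h : (β_ (perp q) (perp p)).hom ≫ (β_ (perp p) (perp q)).hom = 𝟙 _) :
    braidedCycle (p ⅋ q) ≫ prepPar p q =
      perpPar p q ≫ (braidedCycle q ⊗ₘ braidedCycle p) := by
  apply (Pairing.IsDual.tensor (prepPairing_isDual q) (prepPairing_isDual p)).left_ext
  rw [comp_whiskerRight, Category.assoc, whiskerRight_prepPar_counit, braidedCycle_counit,
    comp_whiskerRight, Category.assoc, tensorHom_braidedCycle_counit, h, id_whiskerRight,
    Category.id_comp, BraidedCategory.braiding_naturality_left_assoc, whiskerLeft_perpPar_counit]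

theorem parBraiding_comp_parBraiding {p q : C}
    (h : (β_ (perp q) (perp p)).hom ≫ (β_ (perp p) (perp q)).hom = 𝟙 _) :
    parBraiding p q ≫ parBraiding q p = 𝟙 (p ⅋ q) := by
  have hpq := Pairing.IsDual.par (perpPairing_isDual p) (perpPairing_isDual q)
  have hqp := Pairing.IsDual.par (perpPairing_isDual q) (perpPairing_isDual p)
  rw [parBraiding, parBraiding, hpq.leftMate_comp hqp, h, hpq.leftMate_id]

end Cycle

end StarAut

theorem corollary4p5 {C : Type u} [Category.{v} C] [MonoidalCategory.{v} C]
    [StarAut.ParCategory.{v} C] [StarAut.StarAutonomousCategory.{v} C]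
    [BraidedCategory.{v} C] :
    (StarAut.IsCycle (StarAut.inducedCycle (Iso.refl (𝟭 C))) ↔
      StarAut.TensorBraidingIsSymmetry C) ∧
    (StarAut.TensorBraidingIsSymmetry C → StarAut.ParBraidingIsSymmetry C) := by
  refine ⟨⟨fun h p q => ?_, fun h => ⟨⟨?_, fun p q => ?_⟩, ⟨?_, fun p q => ?_⟩⟩⟩, fun h p q => ?_⟩
  -- The tensor square alone already forces symmetry.
  · exact (StarAut.braidedCycle_tensor_iff p q).1 (h.isTensorSemicycle.tensor p q)
  · exact StarAut.braidedCycle_isDualNatIso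
  · exact (StarAut.braidedCycle_tensor_iff p q).2 (h p q)
  · exact StarAut.braidedCycle_isDualNatIso
  · exact StarAut.braidedCycle_par (h _ _)
  · exact StarAut.parBraiding_comp_parBraiding (h _ _)
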